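/- Fix an integer $k\ge 0$. All manifolds are smooth, finite-dimensional, Hausdorff and second countable, and all vector bundles are smooth, real and of finite rank. For a manifold $N$ let $T^kT^kN$ be the iterated higher tangent bundle, i.e. the set of $(k,k)$-velocities $j^k_{s=0}j^k_{t=0}\gamma(s,t)$ of smooth maps $\gamma:\mathbb R^2\to N$ (two such maps having the same $(k,k)$-velocity iff all derivatives $\partial_s^\alpha\partial_t^\beta f(\gamma(s,t))|_{s=t=0}$, $0\le\alpha,\beta\le k$, $f\in C^\infty(N)$, agree), and let $\tau^{(k,k)}_N:T^kT^kN\to N$, $[\gamma]\mapsto\gamma(0,0)$, be the canonical projection. A vector bundle $\sigma:E\to M$ lifts to a vector bundle $T^kT^k\sigma:T^kT^kE\to T^kT^kM$. A *functorial vector bundle morphism* $F:T^kT^kE\to E$ is a family of vector bundle morphisms $F_E:T^kT^kE\to E$ over base maps $\underline{F_E}:T^kT^kM\to M$, one for every vector bundle $\sigma:E\to M$, such that $F_{E_2}\circ T^kT^kf=f\circ F_{E_1}$ for every vector bundle morphism $f:E_1\to E_2$. (1) For every functorial vector bundle morphism $F:T^kT^kE\to E$ there is a constant $c\in\mathbb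 R$ such that, for every vector bundle $\sigma:E\to M$, $F_E=c\cdot\tau^{(k,k)}_E$ and $\underline{F_E}=\tau^{(k,k)}_M$. (2) A vector $\Phi\in T^kT^kE$ is called semi-holonomic if $T^kT^k\sigma(\Phi)$ lies in $T^{2k}M\subset T^kT^kM$, i.e. is of the form $j^k_{s=0}j^k_{t=0}\,\delta(s+t)$ for a smooth curve $\delta$ in $M$. Let $\Upsilon_{k,\sigma}$ be the canonical map from the bundle of semi-holonomic vectors to $E$, given by $$\langle\Upsilon_{k,\sigma}(\Phi),\xi(0)\rangle=\sum_{j=0}^k(-1)^j\binom kj\,\partial_s^j\partial_t^{k-j}\big\langle v(s,t),\xi(s+t)\big\rangle\Big|_{s=t=0},$$ where $v:\mathbb R^2\to E$ is any smooth map representing $\Phi$ which lies over a map of the form $(s,t)\mapsto\delta(s+t)\in M$, and $\xi$ is any smooth curve in $E^*$ over $\delta$. If $k\ge 1$ and $\sigma:E\to M$ is a vector bundle of positive rank over a non-empty manifold, then there is no functorial vector bundle morphism $F:T^kT^kE\to E$ whose component $F_E$ at $\sigma$ restricts to $\Upsilon_{k,\sigma}$ on the semi-holonomic vectors. -/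

import Mathlib

open Bundle
open scoped Manifold ContDiff

noncomputable section

/-- `∂_s^α ∂_t^β g` at `(s, t) = (0, 0)`. -/
def mixedDeriv (α β : ℕ) (g : ℝ × ℝ → ℝ) : ℝ :=
  iteratedDeriv α (fun s => iteratedDeriv β (fun t => g (s, t)) 0) 0

section Velocities

variable {E E' : Type*} [NormedAddCommGroup E] [NormedSpace ℝ E]
  [NormedAddCommGroup E'] [NormedSpace ℝ E']
  {H H' : Type*} [TopologicalSpace H] [TopologicalSpace H']
  (I : ModelWithCorners ℝ E H) (I' : ModelWithCorners ℝ E' H')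
  (N : Type*) [TopologicalSpace N] [ChartedSpace H N]
  {N' : Type*} [TopologicalSpace N'] [ChartedSpace H' N']

/-- Smooth maps `γ : ℝ × ℝ → N`, `(s, t) ↦ γ (s, t)`. -/
abbrev Surf := C^∞⟮𝓘(ℝ, ℝ × ℝ), ℝ × ℝ; I, N⟯

/-- Two smooth maps `γ, γ' : ℝ² → N` define the same `(k, k)`-velocity `j^k_{s=0} j^k_{t=0}`: they
have the same value at the origin, and all the lifts
`f^{(α, β)} = ∂_s^α ∂_t^β f (γ (s, t)) |_{s = t = 0}`, `α, β ≤ k`, of smooth functions `f : N → ℝ`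
take the same value on them. -/
def velSetoid (k : ℕ) : Setoid (Surf I N) where
  r := fun γ γ' => γ (0, 0) = γ' (0, 0) ∧ ∀ f : C^∞⟮I, N; ℝ⟯, ∀ α ≤ k, ∀ β ≤ k,
    mixedDeriv α β (fun p => f (γ p)) = mixedDeriv α β (fun p => f (γ' p))
  iseqv :=
    { refl := fun _ => ⟨rfl, fun _ _ _ _ _ => rfl⟩
      symm := fun h => ⟨h.1.symm, fun f α hα β hβ => (h.2 f α hα β hβ).symm⟩
      trans := fun h h' => ⟨h.1.trans h'.1,
        fun f α hα β hβ => (h.2 f α hα β hβ).trans (h'.2 f α hα β hβ)⟩ }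

/-- The iterated higher tangent bundle `T^k T^k N`: the set of `(k, k)`-velocities
`j^k_{s=0} j^k_{t=0} γ(s, t)` of smooth maps `γ : ℝ² → N`. -/
def TkTk (k : ℕ) := Quotient (velSetoid I N k)

variable {I N}

/-- The `(k, k)`-velocity `j^k_{s=0} j^k_{t=0} γ(s, t)`. -/
def TkTk.mk (k : ℕ) (γ : Surf I N) : TkTk I N k := Quotient.mk (velSetoid I N k) γ

variable {I'}

/-- The map `T^k T^k φ : T^k T^k N → T^k T^k N'`, `[γ] ↦ [φ ∘ γ]`. -/
def TkTk.map {k : ℕ} (φ : C^∞⟮I, N; I', N'⟯) : TkTk I N k → TkTk I' N' k :=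
  Quotient.lift (fun γ : Surf I N => TkTk.mk k (φ.comp γ)) fun _ _ h =>
    Quotient.sound (s := velSetoid I' N' k) ⟨congrArg φ h.1, fun f α hα β hβ =>
      h.2 (f.comp φ) α hα β hβ⟩

/-- The canonical projection `τ^{(k, k)} : T^k T^k N → N`, `[γ] ↦ γ (0, 0)`. -/
def TkTk.proj {k : ℕ} : TkTk I N k → N :=
  Quotient.lift (fun γ : Surf I N => γ (0, 0)) fun _ _ h => h.1

end Velocities

/-- A smooth real vector bundle of finite rank `σ : E → M` over a finite-dimensional
(Hausdorff, second countable) smooth manifold without boundary. -/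
structure SmoothVB where
  /-- the model vector space of the base -/
  BaseModel : Type
  [normBaseModel : NormedAddCommGroup BaseModel]
  [spaceBaseModel : NormedSpace ℝ BaseModel]
  [finBaseModel : FiniteDimensional ℝ BaseModel]
  /-- the base `M` -/
  Base : Type
  [topBase : TopologicalSpace Base]
  [t2Base : T2Space Base]
  [sccBase : SecondCountableTopology Base]
  [chartBase : ChartedSpace BaseModel Base]
  [manifoldBase : IsManifold 𝓘(ℝ, BaseModel) ∞ Base]
  /-- the model fiber -/
  FibModel : Type
  [normFibModel : NormedAddCommGroup FibModel]
  [spaceFibModel : NormedSpace ℝ FibModel]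
  [finFibModel : FiniteDimensional ℝ FibModel]
  /-- the fibers `E_x`, `x ∈ M` -/
  Fib : Base → Type
  [groupFib : ∀ x, AddCommGroup (Fib x)]
  [moduleFib : ∀ x, Module ℝ (Fib x)]
  [topFib : ∀ x, TopologicalSpace (Fib x)]
  [topTotal : TopologicalSpace (TotalSpace FibModel Fib)]
  [fiberBundle : FiberBundle FibModel Fib]
  [vectorBundle : VectorBundle ℝ FibModel Fib]
  [smoothBundle : ContMDiffVectorBundle ∞ FibModel Fib 𝓘(ℝ, BaseModel)]

namespace SmoothVB

attribute [instance] normBaseModel spaceBaseModel finBaseModel topBase t2Base sccBase chartBase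
  manifoldBase normFibModel spaceFibModel finFibModel groupFib moduleFib topFib topTotal
  fiberBundle vectorBundle smoothBundle

/-- The model with corners of the base `M` (no boundary). -/
abbrev IB (B : SmoothVB) := 𝓘(ℝ, B.BaseModel)

/-- The model with corners of the total space `E` (no boundary). -/
abbrev IT (B : SmoothVB) := (𝓘(ℝ, B.BaseModel)).prod 𝓘(ℝ, B.FibModel)

/-- The total space `E`. -/
abbrev Total (B : SmoothVB) := TotalSpace B.FibModel B.Fib

/-- The total space `E^*` of the dual bundle, with fibers `E_x →L[ℝ] ℝ`. -/
abbrev DualTotal (B : SmoothVB) :=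
  TotalSpace (B.FibModel →L[ℝ] ℝ) (fun x => B.Fib x →L[ℝ] Bundle.Trivial B.Base ℝ x)

/-- The model with corners of `E^*`. -/
abbrev IDual (B : SmoothVB) := (𝓘(ℝ, B.BaseModel)).prod 𝓘(ℝ, B.FibModel →L[ℝ] ℝ)

/-- The bundle projection `σ : E → M` as a smooth map. -/
def sigma (B : SmoothVB) : C^∞⟮B.IT, B.Total; B.IB, B.Base⟯ :=
  ⟨fun e => e.proj, Bundle.contMDiff_proj B.Fib⟩

/-- `T^k T^k E` -/
abbrev TkTkE (k : ℕ) (B : SmoothVB) := TkTk B.IT B.Total k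

/-- `T^k T^k M` -/
abbrev TkTkM (k : ℕ) (B : SmoothVB) := TkTk B.IB B.Base k

/-- `z = a x + b y` for elements `x, y, z` of one fiber of `σ : E → M`. -/
def IsLinComb (B : SmoothVB) (a b : ℝ) (x y z : B.Total) : Prop :=
  ∃ (m : B.Base) (x' y' : B.Fib m), x = ⟨m, x'⟩ ∧ y = ⟨m, y'⟩ ∧ z = ⟨m, a • x' + b • y'⟩

/-- `Z = a X + b Y` for elements `X, Y, Z` of one fiber of the lifted vector bundle
`T^k T^k σ : T^k T^k E → T^k T^k M`, whose operations are the lifts of those of `σ`: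
`a [γ₁] + b [γ₂] = [a γ₁ + b γ₂]` for representatives `γ₁, γ₂ : ℝ² → E` over the same map
`ℝ² → M` (any two elements of a fiber have such representatives). -/
def IsLiftedLinComb (k : ℕ) (B : SmoothVB) (a b : ℝ) (X Y Z : TkTkE k B) : Prop :=
  ∃ γ₁ γ₂ γ₃ : Surf B.IT B.Total, X = TkTk.mk k γ₁ ∧ Y = TkTk.mk k γ₂ ∧ Z = TkTk.mk k γ₃ ∧
    ∀ p, B.IsLinComb a b (γ₁ p) (γ₂ p) (γ₃ p)

/-- A morphism of smooth vector bundles: a map of the bases and linear maps of the fibers which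
together form a smooth map of the total spaces (the map of the bases is then smooth). -/
structure Hom (B C : SmoothVB) where
  base : B.Base → C.Base
  fib : ∀ x, B.Fib x →ₗ[ℝ] C.Fib (base x)
  smooth : ContMDiff B.IT C.IT ∞ fun e : B.Total => (⟨base e.1, fib e.1 e.2⟩ : C.Total)

/-- The map of total spaces of a morphism of vector bundles. -/
def Hom.total {B C : SmoothVB} (f : Hom B C) : C^∞⟮B.IT, B.Total; C.IT, C.Total⟯ :=
  ⟨fun e => ⟨f.base e.1, f.fib e.1 e.2⟩, f.smooth⟩

end SmoothVB

/-- A functorial vector bundle morphism `T^k T^k E → E`: a family of vector bundle morphisms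
`F_E` from `T^k T^k σ : T^k T^k E → T^k T^k M` to `σ : E → M`, indexed by all vector bundles
`σ : E → M`, with `F_{E₂} ∘ T^k T^k f = f ∘ F_{E₁}` for every morphism `f : E₁ → E₂` of vector
bundles. -/
structure FunctorialMorphism (k : ℕ) where
  /-- the map `F_E : T^k T^k E → E` -/
  total : ∀ B : SmoothVB, B.TkTkE k → B.Total
  /-- the map `T^k T^k M → M` of the bases -/
  base : ∀ B : SmoothVB, B.TkTkM k → B.Base
  covers : ∀ (B : SmoothVB) (X : B.TkTkE k), (total B X).proj = base B (TkTk.map B.sigma X)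
  linear : ∀ (B : SmoothVB) (a b : ℝ) (X Y Z : B.TkTkE k),
    B.IsLiftedLinComb k a b X Y Z → B.IsLinComb a b (total B X) (total B Y) (total B Z)
  /-- `F_E` is smooth: it is smooth along every smooth finite-dimensional family
  `x ↦ j^k_{s=0} j^k_{t=0} Γ(x, s, t)` of `(k, k)`-velocities; adapted coordinates on `T^k T^k E`
  provide, locally, such a family which is a diffeomorphism onto an open subset. -/
  smooth : ∀ (B : SmoothVB) (d : ℕ) (Γ : EuclideanSpace ℝ (Fin d) → Surf B.IT B.Total),
    ContMDiff 𝓘(ℝ, EuclideanSpace ℝ (Fin d) × (ℝ × ℝ)) B.IT ∞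
      (fun q : EuclideanSpace ℝ (Fin d) × (ℝ × ℝ) => Γ q.1 q.2) →
    ContMDiff 𝓘(ℝ, EuclideanSpace ℝ (Fin d)) B.IT ∞ (fun x => total B (TkTk.mk k (Γ x)))
  natural : ∀ (B C : SmoothVB) (f : SmoothVB.Hom B C) (X : B.TkTkE k),
    total C (TkTk.map f.total X) = f.total (total B X)

namespace SmoothVB

/-- `Φ ∈ T^k T^k E` is a semi-holonomic vector: it projects to an element of
`T^{2k} M ⊆ T^k T^k M`, i.e. to `j^k_{s=0} j^k_{t=0} δ(s + t)` for a smooth curve `δ` in `M`. -/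
def IsSemiholonomic (k : ℕ) (B : SmoothVB) (Φ : B.TkTkE k) : Prop :=
  ∃ δ : C^∞⟮𝓘(ℝ, ℝ), ℝ; B.IB, B.Base⟯, ∃ h : Surf B.IB B.Base, (∀ p, h p = δ (p.1 + p.2)) ∧
    TkTk.map B.sigma Φ = TkTk.mk k h

/-- `e = Υ_{k,σ}(Φ)` for a semi-holonomic vector `Φ`, i.e.
`⟨e, ξ(0)⟩_σ = ⟨∑_j (-1)^j (k choose j) Φ^{(j, k-j)}, j^k_0 ξ⟩` for all `j^k_0 ξ ∈ T^k E^*` over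
the same `k`-velocity of `M` as the `Φ^{(j, k-j)}`. Here `Φ` is represented by a map
`(s, t) ↦ v (s, t) ∈ E` over `(s, t) ↦ δ(s + t)` and `j^k_0 ξ` by a curve `ξ` in `E^*` over `δ`.
The pairing of `Φ^{(j, k-j)} ∈ T^j T^{k-j} E` with `j^k_0 ξ ∈ T^k E^* ⊆ T^j T^{k-j} E^*` is the
lift of the pairing of `E` and `E^*`, that is `∂_s^j ∂_t^{k-j} ⟨v (s, t), ξ (s + t)⟩` at `0`. -/
def IsUpsilon (k : ℕ) (B : SmoothVB) (Φ : B.TkTkE k) (e : B.Total) : Prop :=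
  ∀ (δ : ℝ → B.Base) (v : ∀ p : ℝ × ℝ, B.Fib (δ (p.1 + p.2)))
    (hv : ContMDiff 𝓘(ℝ, ℝ × ℝ) B.IT ∞ (fun p : ℝ × ℝ => (⟨δ (p.1 + p.2), v p⟩ : B.Total))),
    Φ = TkTk.mk k ⟨fun p : ℝ × ℝ => (⟨δ (p.1 + p.2), v p⟩ : B.Total), hv⟩ →
    ∃ u : B.Fib (δ 0), e = ⟨δ 0, u⟩ ∧
      ∀ ξ : ∀ r : ℝ, B.Fib (δ r) →L[ℝ] ℝ,
        ContMDiff 𝓘(ℝ, ℝ) B.IDual ∞ (fun r : ℝ => (⟨δ r, ξ r⟩ : B.DualTotal)) →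
        ξ 0 u = ∑ j ∈ Finset.range (k + 1), (-1 : ℝ) ^ j * (k.choose j : ℝ) *
          mixedDeriv j (k - j) (fun p => ξ (p.1 + p.2) (v p))

end SmoothVB

end

open Filter Topology

/-! A surface `γ` in `E` is the image of the unit section of the trivial line bundle over the plane
under the morphism `(p, r) ↦ r γ(p)` (`map_homOfSurf`). By naturality `F` is therefore determined by
one point `(q, c)`, its value on the velocity of that section: `F [γ] = c γ(q)` (`total_mk`). A
velocity depends only on the germ at the origin, which forces `q = 0` (`unitValue_fst`), so `F` is
`c` times the projection. For `k ≥ 1` such a multiple kills the velocity of `t ^ k • w` over a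
constant curve, whereas `Υ` sends it to `k! w` (`not_isUpsilon_smul_proj`). -/

/-- The mixed derivatives at the origin depend only on the germ. -/
theorem mixedDeriv_congr_of_eventuallyEq {g g' : ℝ × ℝ → ℝ} (h : g =ᶠ[𝓝 (0, 0)] g') (α β : ℕ) :
    mixedDeriv α β g = mixedDeriv α β g' := by
  apply Filter.EventuallyEq.iteratedDeriv_eq
  filter_upwards [h.curry_nhds] with s hs
  exact Filter.EventuallyEq.iteratedDeriv_eq β hs

/-- With the next lemma, this evaluates the sum defining `Υ` on `t ^ k • w`: only the term `j = 0`
survives. -/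
theorem mixedDeriv_snd_pow_mul_of_pos {α : ℕ} (hα : α ≠ 0) (β k : ℕ) (a : ℝ) :
    mixedDeriv α β (fun p => p.2 ^ k * a) = 0 := by
  simp [mixedDeriv, iteratedDeriv_const, hα]

theorem mixedDeriv_zero_snd_pow_mul (k : ℕ) (a : ℝ) :
    mixedDeriv 0 k (fun p => p.2 ^ k * a) = k.factorial * a := by
  simp only [mixedDeriv, iteratedDeriv_zero]
  simp [iteratedDeriv_mul_const_field, iteratedDeriv_pow, Nat.descFactorial_self]

section Velocities

variable {E H : Type*} [NormedAddCommGroup E] [NormedSpace ℝ E] [TopologicalSpace H]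
  {I : ModelWithCorners ℝ E H} {N : Type*} [TopologicalSpace N] [ChartedSpace H N]

/-- Surfaces with the same germ at the origin have the same `(k, k)`-velocity. -/
theorem TkTk.mk_eq_of_eventuallyEq (k : ℕ) {γ γ' : Surf I N}
    (h : (γ : ℝ × ℝ → N) =ᶠ[𝓝 (0, 0)] γ') : TkTk.mk k γ = TkTk.mk k γ' :=
  Quotient.sound (s := velSetoid I N k) ⟨h.eq_of_nhds, fun f α _ β _ =>
    mixedDeriv_congr_of_eventuallyEq (h.fun_comp f) α β⟩

end Velocities

namespace SmoothVB

/-- Fiberwise scalar multiplication of a smooth map into `E` by a smooth function is smooth. -/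
theorem contMDiff_smul (B : SmoothVB) {E H N : Type*} [NormedAddCommGroup E] [NormedSpace ℝ E]
    [TopologicalSpace H] {I : ModelWithCorners ℝ E H} [TopologicalSpace N] [ChartedSpace H N]
    {r : N → ℝ} {γ : N → B.Total} (hr : ContMDiff I 𝓘(ℝ, ℝ) ∞ r) (hγ : ContMDiff I B.IT ∞ γ) :
    ContMDiff I B.IT ∞ fun x => (⟨(γ x).1, r x • (γ x).2⟩ : B.Total) := by
  intro x
  obtain ⟨h₁, h₂⟩ := (Bundle.contMDiffAt_totalSpace (IB := B.IB)).1 (hγ x)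
  refine (Bundle.contMDiffAt_totalSpace (IB := B.IB)).2 ⟨h₁, ?_⟩
  refine ((hr x).smul h₂).congr_of_eventuallyEq ?_
  let e := trivializationAt B.FibModel B.Fib (γ x).1
  -- The trivialization is linear only on fibers over its base set, so scalars come out only near
  -- `x`.
  have hmem : ∀ᶠ y in 𝓝 x, (γ y).1 ∈ e.baseSet :=
    h₁.continuousAt.eventually (e.open_baseSet.mem_nhds (mem_baseSet_trivializationAt _ _ _))
  filter_upwards [hmem] with y hy
  exact (e.linear ℝ hy).map_smul (r y) (γ y).2

/-- The trivial line bundle over the plane. -/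
noncomputable def planeLine : SmoothVB where
  BaseModel := ℝ × ℝ
  Base := ℝ × ℝ
  FibModel := ℝ
  Fib := Bundle.Trivial (ℝ × ℝ) ℝ

/-- The section of the trivial line bundle with constant value `1`, along a map of the plane. -/
noncomputable def planeSection (φ : ℝ × ℝ → ℝ × ℝ) (hφ : ContDiff ℝ ∞ φ) :
    Surf planeLine.IT planeLine.Total :=
  ⟨fun p => ⟨φ p, (1 : ℝ)⟩, fun p => (Bundle.contMDiffAt_totalSpace (IB := planeLine.IB)).2
    ⟨hφ.contMDiff p, contMDiffAt_const⟩⟩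

/-- A surface `γ` in `E` induces the morphism `(p, r) ↦ r γ(p)` from the trivial line bundle over
the plane. -/
noncomputable def homOfSurf (B : SmoothVB) (γ : Surf B.IT B.Total) : Hom planeLine B where
  base := fun p => (γ p).1
  fib := fun p => LinearMap.toSpanSingleton ℝ (B.Fib (γ p).1) (γ p).2
  smooth := by
    have hp : ContMDiff planeLine.IT planeLine.IB ∞ fun e : planeLine.Total => e.1 :=
      Bundle.contMDiff_proj planeLine.Fib
    have hr : ContMDiff planeLine.IT 𝓘(ℝ, ℝ) ∞ fun e : planeLine.Total => (e.2 : ℝ) :=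
      fun e => ((Bundle.contMDiffAt_totalSpace (IB := planeLine.IB)).1
        (contMDiffAt_id (x := e))).2
    exact B.contMDiff_smul hr (γ.contMDiff.comp hp)

theorem homOfSurf_total_apply (B : SmoothVB) (γ : Surf B.IT B.Total) (p : ℝ × ℝ) (r : ℝ) :
    (B.homOfSurf γ).total ⟨p, r⟩ = ⟨(γ p).1, r • (γ p).2⟩ := rfl

/-- Every `(k, k)`-velocity is the image of that of the unit section of the line bundle over the
plane. -/
theorem map_homOfSurf (k : ℕ) (B : SmoothVB) (γ : Surf B.IT B.Total) :
    TkTk.map (B.homOfSurf γ).total (TkTk.mk k (planeSection id contDiff_id)) = TkTk.mk k γ := by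
  refine congrArg (TkTk.mk k) (ContMDiffMap.ext fun p => ?_)
  exact (B.homOfSurf_total_apply γ p 1).trans (by rw [one_smul])

end SmoothVB

/-- The plane carries smooth maps which have the germ of the identity at the origin and vanish at
a given point. -/
theorem exists_contDiff_eventuallyEq_id (q : ℝ × ℝ) (hq : q ≠ 0) :
    ∃ φ : ℝ × ℝ → ℝ × ℝ, ContDiff ℝ ∞ φ ∧ φ =ᶠ[𝓝 (0, 0)] id ∧ φ q = 0 := by
  have hpos : 0 < ‖q‖ := norm_pos_iff.2 hq
  -- The outer radius `‖q‖` makes the bump vanish at `q` itself.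
  let b : ContDiffBump (0 : ℝ × ℝ) := ⟨‖q‖ / 2, ‖q‖, by positivity, by linarith⟩
  refine ⟨fun p => b p • p, b.contDiff.smul contDiff_id, ?_, ?_⟩
  · filter_upwards [b.eventuallyEq_one] with p hp
    simp [hp]
  · simp [b.zero_of_le_dist (x := q) (by simp [b])]

namespace FunctorialMorphism

open SmoothVB

variable {k : ℕ} (F : FunctorialMorphism k)

/-- The value of `F` at the velocity of the unit section over the plane. -/
noncomputable def unitValue : planeLine.Total := F.total planeLine (TkTk.mk k (planeSection id contDiff_id))

theorem total_mk (B : SmoothVB) (γ : Surf B.IT B.Total) :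
    F.total B (TkTk.mk k γ) =
      ⟨(γ F.unitValue.1).1, (show ℝ from F.unitValue.2) • (γ F.unitValue.1).2⟩ := by
  rw [← map_homOfSurf, F.natural]
  rfl

/-- If `q ≠ 0`, a map `φ` with the germ of the identity at the origin and `φ q = 0` gives the same
velocity, so its value lies over both `q` and `φ q = 0`. -/
theorem unitValue_fst : F.unitValue.1 = ((0, 0) : ℝ × ℝ) := by
  by_contra hq
  obtain ⟨φ, hφ, hid, hzero⟩ := exists_contDiff_eventuallyEq_id F.unitValue.1 hq
  have h := F.total_mk planeLine (planeSection φ hφ)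
  rw [TkTk.mk_eq_of_eventuallyEq k (γ' := planeSection id contDiff_id)
    (hid.fun_comp fun p => (⟨p, (1 : ℝ)⟩ : planeLine.Total))] at h
  exact hq ((congrArg TotalSpace.proj h).trans hzero)

/-- A functorial morphism is a constant multiple of the canonical projection. -/
theorem total_eq (B : SmoothVB) (X : B.TkTkE k) :
    F.total B X = ⟨(TkTk.proj X).1, (show ℝ from F.unitValue.2) • (TkTk.proj X).2⟩ := by
  induction X using Quotient.inductionOn with
  | h γ =>
    have h := F.total_mk B γ
    rw [F.unitValue_fst] at h
    exact h

/-- The base map of a functorial morphism is the canonical projection. -/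
theorem base_eq (B : SmoothVB) (Y : B.TkTkM k) : F.base B Y = TkTk.proj Y := by
  induction Y using Quotient.inductionOn with
  | h h =>
    -- The zero section lifts `h` to `E`, so `covers` gives the base map.
    let γ : Surf B.IT B.Total := ⟨fun p => ⟨h p, 0⟩,
      (Bundle.contMDiff_zeroSection ℝ B.Fib).comp h.contMDiff⟩
    have hY : TkTk.map B.sigma (TkTk.mk k γ) = TkTk.mk k h :=
      congrArg (TkTk.mk k) (ContMDiffMap.ext fun _ => rfl)
    have hc := F.covers B (TkTk.mk k γ)
    rw [hY, F.total_eq] at hc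
    exact hc.symm

end FunctorialMorphism

namespace SmoothVB

/-- A vector bundle of positive rank has a fiber functional which is non-zero at some vector. -/
theorem exists_functional_ne_zero (B : SmoothVB) [Nontrivial B.FibModel] (m : B.Base) :
    ∃ (w : B.Fib m) (ξ : B.Fib m →L[ℝ] ℝ), ξ w ≠ 0 := by
  obtain ⟨w, hw⟩ := exists_ne (0 : B.FibModel)
  obtain ⟨f, hf⟩ := SeparatingDual.exists_ne_zero (R := ℝ) hw
  let e := (trivializationAt B.FibModel B.Fib m).continuousLinearEquivAt ℝ m
    (mem_baseSet_trivializationAt _ _ _)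
  exact ⟨e.symm w, f.comp e.toContinuousLinearMap, by simpa using hf⟩

/-- No multiple of the canonical projection restricts to `Υ` for `k ≥ 1` and positive rank. -/
theorem not_isUpsilon_smul_proj {k : ℕ} (hk : 1 ≤ k) (B : SmoothVB) [Nontrivial B.FibModel]
    (m : B.Base) (c : ℝ) : ∃ Φ : B.TkTkE k, B.IsSemiholonomic k Φ ∧
      ¬ B.IsUpsilon k Φ ⟨(TkTk.proj Φ).1, c • (TkTk.proj Φ).2⟩ := by
  obtain ⟨w, ξ, hξ⟩ := B.exists_functional_ne_zero m
  have hv : ContMDiff 𝓘(ℝ, ℝ × ℝ) B.IT ∞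
      fun p : ℝ × ℝ => (⟨m, p.2 ^ k • w⟩ : B.Total) :=
    B.contMDiff_smul (γ := fun _ => ⟨m, w⟩) (contDiff_snd.pow k).contMDiff contMDiff_const
  refine ⟨TkTk.mk k ⟨_, hv⟩, ⟨ContMDiffMap.const m, ContMDiffMap.const m, fun _ => rfl,
    congrArg (TkTk.mk k) (ContMDiffMap.ext fun _ => rfl)⟩, fun h => ?_⟩
  obtain ⟨u, hu, hpair⟩ := h (fun _ => m) (fun p => p.2 ^ k • w) hv rfl
  have hu0 : u = 0 := by
    have h0 : c • ((0 : ℝ) ^ k • w) = u := eq_of_heq (TotalSpace.mk.inj hu).2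
    -- Here `k ≥ 1` enters: `t ^ k` vanishes at the origin.
    rw [← h0, zero_pow (by omega), zero_smul, smul_zero]
  have hsum := hpair (fun _ => ξ) contMDiff_const
  simp only [hu0, map_zero, map_smul, smul_eq_mul] at hsum
  -- What remains is `0 = k! ξ(w)`, contradicting `hξ`.
  rw [Finset.sum_eq_single_of_mem 0 (by simp) fun j _ hj => by
    rw [mixedDeriv_snd_pow_mul_of_pos hj, mul_zero], Nat.sub_zero,
    mixedDeriv_zero_snd_pow_mul] at hsum
  simp [hξ, Nat.factorial_ne_zero] at hsum

end SmoothVB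

theorem mainTheorem5 (k : ℕ) :
    (∀ F : FunctorialMorphism k, ∃ c : ℝ, ∀ B : SmoothVB,
      (∀ Y : B.TkTkM k, F.base B Y = TkTk.proj Y) ∧
      (∀ X : B.TkTkE k, F.total B X = ⟨(TkTk.proj X).1, c • (TkTk.proj X).2⟩)) ∧
    (1 ≤ k → ∀ B : SmoothVB, Nonempty B.Base → Nontrivial B.FibModel →
      ¬ ∃ F : FunctorialMorphism k, ∀ Φ : B.TkTkE k, B.IsSemiholonomic k Φ →
        B.IsUpsilon k Φ (F.total B Φ)) := by
  refine ⟨fun F => ⟨F.unitValue.2, fun B => ⟨F.base_eq B, F.total_eq B⟩⟩, ?_⟩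
  rintro hk B ⟨m⟩ _ ⟨F, hF⟩
  obtain ⟨Φ, hΦ, hn⟩ := B.not_isUpsilon_smul_proj hk m F.unitValue.2
  exact hn (F.total_eq B Φ ▸ hF Φ hΦ)
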